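/- **Definitions.** A *measurement scenario* $S=(X_S,O_S,\Sigma_S)$ consists of a finite set $X_S$ of measurements, finite non-empty outcome sets $O_{S,x}$ ($x\in X_S$), and a simplicial complex $\Sigma_S$ on $X_S$ (a down-closed family of subsets of $X_S$ containing $\emptyset$ and all singletons), whose faces are called contexts. Put $\mathcal E_S(U)=\prod_{x\in U}O_{S,x}$ for $U\subseteq X_S$. A *deterministic procedure* $f=(\pi,\alpha)\colon S\to T$ consists of a relation $\pi$ from $X_T$ to $X_S$ such that $\pi(\sigma)=\bigcup_{x\in\sigma}\pi(x)\in\Sigma_S$ for all $\sigma\in\Sigma_T$, and functions $\alpha_x\colon\mathcal E_S(\pi(x))\to O_{T,x}$ for $x\in X_T$; these assemble into $\alpha_U\colon\mathcal E_S(\pi(U))\to\mathcal E_T(U)$ for $U\subseteq X_T$, and procedures compose in the evident way. A *possibilistic model* $e$ on $S$ is a family of non-empty sets $e_\sigma\subseteq\mathcal E_S(\sigma)$ ($\sigma\in\Sigma_S$) with $e_\tau=e_\sigma|_\tau$ whenever $\tau\subseteq\sigma$; its push-forward along $f$ is $(f_*e)_\sigma=\alpha_\sigma(e_{\pi(\sigma)})$.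 A *possibilistic predicate* on $S$ is a non-empty set of deterministic procedures from $S$ to the scenario $\mathbf 2$ with one measurement and outcomes $0,1$; a model *satisfies* it if the union of its push-forwards along these procedures is the model on $\mathbf 2$ with the certain outcome $1$. A possibilistic model $e$ induces the predicate $g(e)$ formed by the procedures $(\sigma,\chi_{e_\sigma})$, $\sigma\in\Sigma_S$, which measure the context $\sigma$ and return $1$ exactly on $e_\sigma$; the predicate $g(e)$ determines $e$. The category $\mathbf{Sceng}_{\mathrm{Det}}$ has as objects the pairs $\langle S,g\rangle$ of a scenario $S$ and a predicate $g$ on $S$ induced by a possibilistic model, whose supports are written $g_\sigma$. Its morphisms $\langle S,g\rangle\to\langle T,h\rangle$ are the deterministic procedures $f\colon S\to T$ such that $f_*e$ satisfies $h$ for every possibilistic model $e$ on $S$ satisfying $g$. For objects $\langle S,g\rangle,\langle T,h\rangle$, let $[S,T]$ be the scenario with the measurements and contexts of $T$ and with $O_{[S,T],x}=\{\langle U,k\rangle : U\subseteq X_S,\ k\colon\mathcal E_S(U)\to O_{T,x}\}$. Let $[\langle S,g\rangle,\langle T,h\rangle]$ be $[S,T]$ with the predicate induced by the possibilistic model whose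 set at $\sigma\in\Sigma_T$ consists of the families $(\langle U_x,k_x\rangle)_{x\in\sigma}$ such that $U=\bigcup_{x\in\sigma}U_x\in\Sigma_S$ and $(k_x(s|_{U_x}))_{x\in\sigma}\in h_\sigma$ for every $s\in g_U$. Let $\langle 0,\mathsf t\rangle$ be the scenario without measurements, with the predicate induced by its unique model. For procedures $f=(\pi,\alpha)\colon S\to T$ and scenarios $P$ define the procedures - $[\mathrm{id},f]\colon[P,S]\to[P,T]$, with relation $\pi$, sending $(\langle U_y,k_y\rangle)_{y\in\pi(x)}$ to $\langle V,\ s\mapsto\alpha_x((k_y(s|_{U_y}))_{y\in\pi(x)})\rangle$, where $V=\bigcup_{y\in\pi(x)}U_y$; - $[f,\mathrm{id}]\colon[T,P]\to[S,P]$, with the identity relation, sending $\langle U,k\rangle$ to $\langle\pi(U),k\circ\alpha_U\rangle$; - $i_S\colon S\to[0,S]$, with the identity relation, sending $o\in O_{S,x}$ to $\langle\emptyset,*\mapsto o\rangle$; - $j_S\colon 0\to[S,S]$, with the empty relation, whose value at $x$ is $\langle\{x\},\mathrm{id}\rangle$; - $L^P_{S,T}\colon[S,T]\to[[P,S],[P,T]]$,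 with the identity relation, sending $\langle U,k\rangle$ to $\langle U,\tilde k\rangle$, where $\tilde k((\langle V_y,m_y\rangle)_{y\in U})=\langle V,\ s\mapsto k((m_y(s|_{V_y}))_{y\in U})\rangle$ and $V=\bigcup_{y\in U}V_y$. **Theorem.** These procedures are morphisms of $\mathbf{Sceng}_{\mathrm{Det}}$ (for $[\mathrm{id},f]$ and $[f,\mathrm{id}]$: whenever $f$ is a morphism, and between the objects $[-,-]$ above), and they make $\mathbf{Sceng}_{\mathrm{Det}}$ into a closed category with unit $1=\langle 0,\mathsf t\rangle$. That is, $[-,-]$ is a bifunctor $\mathbf{Sceng}_{\mathrm{Det}}^{\mathrm{op}}\times\mathbf{Sceng}_{\mathrm{Det}}\to\mathbf{Sceng}_{\mathrm{Det}}$; $i_A\colon A\to[1,A]$ is a natural isomorphism; $j_A\colon 1\to[A,A]$ is dinatural in $A$; $L^A_{B,C}\colon[B,C]\to[[A,B],[A,C]]$ is natural in $B$ and $C$ and dinatural in $A$; and for all objects $A,B,C,D$: - (CC1) $L^A_{B,B}\circ j_B=j_{[A,B]}$; - (CC2) $[j_A,\mathrm{id}]\circ L^A_{A,C}=i_{[A,C]}$;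 - (CC3) $[L^A_{B,C},\mathrm{id}]\circ L^{[A,B]}_{[A,C],[A,D]}\circ L^A_{C,D}=[\mathrm{id},L^A_{B,D}]\circ L^B_{C,D}$; - (CC4) $[i_B,\mathrm{id}]\circ L^{1}_{B,C}=[\mathrm{id},i_C]$; - (CC5) the map $\mathrm{Hom}(A,B)\to\mathrm{Hom}(1,[A,B])$, $f\mapsto[\mathrm{id},f]\circ j_A$, is a bijection. -/

import Mathlib

open CategoryTheory

universe v u

namespace Contextuality

/-! ### Measurement scenarios -/

/-- A measurement scenario: a finite set `X` of measurements, a finite non-empty set `O x` of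
outcomes for each measurement `x`, and a simplicial complex `faces` on `X`, whose faces are the
contexts (the empty set is a face, and every singleton is one). -/
structure Scenario : Type (u + 1) where
  X : Type u
  O : X → Type u
  faces : Set (Set X)
  finite_X : Finite X
  finite_O : ∀ x, Finite (O x)
  nonempty_O : ∀ x, Nonempty (O x)
  empty_mem : ∅ ∈ faces
  singleton_mem : ∀ x, {x} ∈ faces
  down_closed : ∀ σ ∈ faces, ∀ τ, τ ⊆ σ → τ ∈ faces

/-- The event sheaf: `S.Ev U = ∏_{x ∈ U} O x`. -/
abbrev Scenario.Ev (S : Scenario.{u}) (U : Set S.X) : Type u := ∀ x, x ∈ U → S.O x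

/-- The restriction maps of the event sheaf. -/
def Scenario.restrict (S : Scenario.{u}) {U V : Set S.X} (h : U ⊆ V) (s : S.Ev V) : S.Ev U :=
  fun x hx => s x (h hx)

/-- The image `R(U)` of a set under a relation, given as `x ↦ R(x)`. -/
def relImage {X Y : Type u} (R : X → Set Y) (U : Set X) : Set Y := {y | ∃ x ∈ U, y ∈ R x}

/-! ### Deterministic procedures -/

/-- A deterministic procedure `S ⟶ T`: a simplicial relation `π` from the complex of `T` to the
complex of `S`, and functions `α x : Ev_S (π x) → O_{T,x}`. -/
structure DetProc (S T : Scenario.{u}) : Type u where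
  π : T.X → Set S.X
  simplicial : ∀ σ ∈ T.faces, relImage π σ ∈ S.faces
  α : ∀ x, S.Ev (π x) → T.O x

namespace DetProc

theorem ext_of {S T : Scenario.{u}} {f g : DetProc S T} (hπ : ∀ x, f.π x = g.π x)
    (hα : ∀ x (s : S.Ev (g.π x)), f.α x (fun y hy => s y (hπ x ▸ hy)) = g.α x s) : f = g := by
  obtain ⟨π, _, α⟩ := f
  obtain ⟨π', _, α'⟩ := g
  obtain rfl : π = π' := funext hπ
  obtain rfl : α = α' := funext fun x => funext fun s => hα x s
  rfl

/-- The map `α_σ : Ev_S (π σ) → Ev_T σ` assembled from the `α_x`, `x ∈ σ`. -/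
def act {S T : Scenario.{u}} (f : DetProc S T) (σ : Set T.X) (s : S.Ev (relImage f.π σ)) :
    T.Ev σ :=
  fun x hx => f.α x fun y hy => s y ⟨x, hx, hy⟩

/-- The identity procedure. -/
def id (S : Scenario.{u}) : DetProc S S where
  π x := {x}
  simplicial σ hσ := S.down_closed σ hσ _ (by rintro y ⟨x, hx, rfl⟩; exact hx)
  α x s := s x rfl

/-- Composition of procedures, in diagrammatic order. -/
def comp {S T P : Scenario.{u}} (f : DetProc S T) (g : DetProc T P) : DetProc S P where
  π x := relImage f.π (g.π x)
  simplicial σ hσ := S.down_closed _ (f.simplicial _ (g.simplicial σ hσ)) _ (by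
    rintro z ⟨x, hx, y, hy, hz⟩; exact ⟨y, ⟨x, hx, hy⟩, hz⟩)
  α x s := g.α x (f.act (g.π x) s)

theorem id_comp {S T : Scenario.{u}} (f : DetProc S T) : (id S).comp f = f :=
  ext_of (fun x => by ext y; simp [comp, id, relImage]) fun _ _ => rfl

theorem comp_id {S T : Scenario.{u}} (f : DetProc S T) : f.comp (id T) = f :=
  ext_of (fun x => by ext y; simp [comp, id, relImage]) fun _ _ => rfl

theorem comp_assoc {S T P Q : Scenario.{u}} (f : DetProc S T) (g : DetProc T P)
    (h : DetProc P Q) : (f.comp g).comp h = f.comp (g.comp h) :=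
  ext_of (fun x => by
    ext z
    constructor
    · rintro ⟨x, hx, y, hy, hz⟩; exact ⟨y, ⟨x, hx, hy⟩, hz⟩
    · rintro ⟨y, ⟨x, hx, hy⟩, hz⟩; exact ⟨x, hx, y, hy, hz⟩) fun _ _ => rfl

end DetProc

/-! ### Possibilistic empirical models -/

/-- A possibilistic empirical model on `S`: a non-empty set `supp σ` of joint outcomes for each
context `σ`, with `supp τ = (supp σ)|_τ` whenever `τ ⊆ σ`. -/
@[ext]
structure PossModel (S : Scenario.{u}) : Type u where
  supp : ∀ σ ∈ S.faces, Set (S.Ev σ)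
  nonempty : ∀ σ (hσ : σ ∈ S.faces), (supp σ hσ).Nonempty
  compat : ∀ σ (hσ : σ ∈ S.faces) τ (hτ : τ ∈ S.faces) (h : τ ⊆ σ),
    supp τ hτ = S.restrict h '' supp σ hσ

/-- The push-forward `EMP_𝔹(f) e`: at the context `σ` of `T` it is the image of `e_{π σ}` under
`α_σ`. -/
def DetProc.push {S T : Scenario.{u}} (f : DetProc S T) (e : PossModel S) : PossModel T where
  supp σ hσ := f.act σ '' e.supp _ (f.simplicial σ hσ)
  nonempty σ hσ := (e.nonempty _ _).image _
  compat σ hσ τ hτ h := by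
    have h' : relImage f.π τ ⊆ relImage f.π σ := fun y ⟨x, hx, hy⟩ => ⟨x, h hx, hy⟩
    rw [e.compat _ (f.simplicial σ hσ) _ (f.simplicial τ hτ) h', Set.image_image, Set.image_image]
    rfl

/-- The deterministic model `δ_s` given by a global assignment `s`. -/
def PossModel.det {S : Scenario.{u}} (s : ∀ x, S.O x) : PossModel S where
  supp _ _ := {fun x _ => s x}
  nonempty _ _ := Set.singleton_nonempty _
  compat σ hσ τ hτ h := by rw [Set.image_singleton]; rfl

/-- A possibilistic procedure `S → T`: a Boolean distribution on, that is a non-empty set of,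
deterministic procedures. -/
structure PossProc (S T : Scenario.{u}) : Type u where
  procs : Set (DetProc S T)
  nonempty : procs.Nonempty

/-- The push-forward of a model along a possibilistic procedure, `⋁ f_i` acting as the union of
the push-forwards along the `f_i`. -/
def PossProc.push {S T : Scenario.{u}} (F : PossProc S T) (e : PossModel S) : PossModel T where
  supp σ hσ := {t | ∃ f ∈ F.procs, t ∈ (f.push e).supp σ hσ}
  nonempty σ hσ := by
    obtain ⟨f, hf⟩ := F.nonempty
    obtain ⟨t, ht⟩ := (f.push e).nonempty σ hσ
    exact ⟨t, f, hf, ht⟩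
  compat σ hσ τ hτ h := by
    ext t
    constructor
    · rintro ⟨f, hf, ht⟩
      rw [(f.push e).compat σ hσ τ hτ h] at ht
      obtain ⟨s, hs, rfl⟩ := ht
      exact ⟨s, ⟨f, hf, hs⟩, rfl⟩
    · rintro ⟨s, ⟨f, hf, hs⟩, rfl⟩
      refine ⟨f, hf, ?_⟩
      rw [(f.push e).compat σ hσ τ hτ h]
      exact ⟨s, hs, rfl⟩

/-! ### Predicates -/

/-- The scenario with a single measurement, which has two outcomes (`false` is the outcome `0`,
`true` is the outcome `1`). -/
abbrev two : Scenario.{u} where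
  X := PUnit
  O _ := ULift Bool
  faces := Set.univ
  finite_X := inferInstance
  finite_O _ := inferInstance
  nonempty_O _ := inferInstance
  empty_mem := trivial
  singleton_mem _ := trivial
  down_closed _ _ _ _ := trivial

/-- A possibilistic predicate on `S` is a possibilistic procedure `S → two`. -/
abbrev Predicate (S : Scenario.{u}) : Type u := PossProc S two.{u}

/-- `e` satisfies the predicate `g` if `EMP_𝔹(g) e` is the model on `two` corresponding to the
deterministic outcome `1`. -/
def PossModel.Satisfies {S : Scenario.{u}} (e : PossModel S) (g : Predicate S) : Prop :=
  g.push e = PossModel.det fun _ => ULift.up true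

open Classical in
/-- The deterministic predicate on `S` given by a context `σ` and a subset `A` of `Ev_S σ`: its
relation sends the unique measurement to `σ`, and its function is the characteristic function
of `A`. -/
noncomputable def detPredicate (S : Scenario.{u}) (σ : Set S.X) (hσ : σ ∈ S.faces)
    (A : Set (S.Ev σ)) : DetProc S two.{u} where
  π _ := σ
  simplicial _ _ := S.down_closed σ hσ _ fun _ ⟨_, _, hy⟩ => hy
  α _ s := ULift.up (decide (s ∈ A))

/-- The predicate `g(e) = ⋁_σ g(e)_σ` induced by a possibilistic model `e`. -/
def PossModel.predicate {S : Scenario.{u}} (e : PossModel S) : Predicate S where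
  procs := {f | ∃ σ, ∃ hσ : σ ∈ S.faces, f = detPredicate S σ hσ (e.supp σ hσ)}
  nonempty := ⟨_, ∅, S.empty_mem, rfl⟩

/-- The predicate `g(e)` determines `e`, so that a pair of a scenario and a predicate on it that
is induced by a possibilistic model is the same thing as a pair of a scenario and a possibilistic
model on it. -/
theorem PossModel.predicate_injective (S : Scenario.{u}) :
    Function.Injective (PossModel.predicate (S := S)) := by
  intro d e h
  ext σ hσ s
  have hm : detPredicate S σ hσ (d.supp σ hσ) ∈ e.predicate.procs := by
    rw [← h]; exact ⟨σ, hσ, rfl⟩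
  obtain ⟨τ, hτ, hf⟩ := hm
  obtain rfl : σ = τ := congrFun (congrArg DetProc.π hf) PUnit.unit
  have hα := congrFun (congrFun (eq_of_heq (DetProc.mk.inj hf).2) PUnit.unit) s
  simpa using congrArg ULift.down hα

/-! ### The category of scenarios with structure predicates -/

/-- A pair `⟨S, g⟩` of a scenario and a structure predicate on it that is induced by a possibilistic
model. The inducing model, which is determined by the predicate, is what is stored. -/
structure ScengDet : Type (u + 1) where
  scen : Scenario.{u}
  model : PossModel scen

/-- The structure predicate. -/
def ScengDet.pred (A : ScengDet.{u}) : Predicate A.scen := A.model.predicate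

/-- A morphism `⟨S, g⟩ ⟶ ⟨T, h⟩`: a deterministic procedure `S → T` that sends the possibilistic
models which satisfy `g` to models which satisfy `h`. -/
@[ext]
structure ScengDet.Hom (A B : ScengDet.{u}) : Type u where
  proc : DetProc A.scen B.scen
  preserves : ∀ e : PossModel A.scen, e.Satisfies A.pred → (proc.push e).Satisfies B.pred

theorem DetProc.push_id {S : Scenario.{u}} (e : PossModel S) : (DetProc.id S).push e = e := by
  ext σ hσ t
  have h : relImage (DetProc.id S).π σ = σ := by ext y; simp [DetProc.id, relImage]
  change t ∈ (DetProc.id S).act σ '' _ ↔ _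
  rw [e.compat σ hσ _ ((DetProc.id S).simplicial σ hσ) h.subset, Set.image_image]
  change t ∈ (fun s => s) '' _ ↔ _
  simp

theorem DetProc.push_comp {S T P : Scenario.{u}} (f : DetProc S T) (g : DetProc T P)
    (e : PossModel S) : (f.comp g).push e = g.push (f.push e) := by
  ext σ hσ t
  have h : relImage (f.comp g).π σ ⊆ relImage f.π (relImage g.π σ) := by
    rintro z ⟨x, hx, y, hy, hz⟩; exact ⟨y, ⟨x, hx, hy⟩, hz⟩
  change t ∈ (f.comp g).act σ '' _ ↔ t ∈ g.act σ '' (f.act _ '' _)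
  rw [e.compat _ (f.simplicial _ (g.simplicial σ hσ)) _ ((f.comp g).simplicial σ hσ) h,
    Set.image_image, Set.image_image]
  rfl

instance : Category.{u} ScengDet.{u} where
  Hom := ScengDet.Hom
  id A := ⟨DetProc.id A.scen, fun e he => by rwa [DetProc.push_id]⟩
  comp f g := ⟨f.proc.comp g.proc, fun e he => by
    rw [DetProc.push_comp]; exact g.preserves _ (f.preserves _ he)⟩
  id_comp f := ScengDet.Hom.ext (DetProc.id_comp f.proc)
  comp_id f := ScengDet.Hom.ext (DetProc.comp_id f.proc)
  assoc f g h := ScengDet.Hom.ext (DetProc.comp_assoc f.proc g.proc h.proc)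

/-! ### The internal hom -/

/-- The scenario `[S, T]`: it has the measurements and contexts of `T`, and the outcomes of `x` are
the pairs `⟨U, k⟩` of a subset `U` of the measurements of `S` and a function
`k : Ev_S U → O_{T,x}`. -/
abbrev Scenario.hom (S T : Scenario.{u}) : Scenario.{u} where
  X := T.X
  O x := Σ U : Set S.X, (S.Ev U → T.O x)
  faces := T.faces
  finite_X := T.finite_X
  finite_O x := by
    have := S.finite_X
    have := S.finite_O
    have := T.finite_O
    have (U : Set S.X) : Finite (S.Ev U) := inferInstance
    infer_instance
  nonempty_O x := ⟨⟨∅, fun _ => (T.nonempty_O x).some⟩⟩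
  empty_mem := T.empty_mem
  singleton_mem := T.singleton_mem
  down_closed := T.down_closed

/-- The union `⋃_{x ∈ σ} U_x` of the sets used by a joint outcome `(⟨U_x, k_x⟩)_{x ∈ σ}`. -/
def homUnion {S T : Scenario.{u}} {σ : Set T.X} (p : (S.hom T).Ev σ) : Set S.X :=
  {y | ∃ x, ∃ hx : x ∈ σ, y ∈ (p x hx).1}

/-- The function `s ↦ (k_x (s|_{U_x}))_{x ∈ σ}` from `Ev_S (⋃_{x ∈ σ} U_x)` to `Ev_T σ` that is
given by a joint outcome `(⟨U_x, k_x⟩)_{x ∈ σ}`. -/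
def homJoint {S T : Scenario.{u}} {σ : Set T.X} (p : (S.hom T).Ev σ) (s : S.Ev (homUnion p)) :
    T.Ev σ :=
  fun x hx => (p x hx).2 fun y hy => s y ⟨x, hx, hy⟩

/-- The subset of `Ev_{[S,T]} σ` of those `(⟨U_x, k_x⟩)_{x ∈ σ}` for which `U = ⋃_{x ∈ σ} U_x` is
a context of `S` and the induced function `Ev_S U → Ev_T σ` sends assignments in `g_U` to
assignments in `h_σ`. -/
def homSupp {S T : Scenario.{u}} (g : PossModel S) (h : PossModel T) (σ : Set T.X)
    (hσ : σ ∈ T.faces) : Set ((S.hom T).Ev σ) :=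
  {p | ∃ hU : homUnion p ∈ S.faces, ∀ s ∈ g.supp _ hU, homJoint p s ∈ h.supp σ hσ}

theorem homSupp_compat {S T : Scenario.{u}} (g : PossModel S) (h : PossModel T) (σ : Set T.X)
    (hσ : σ ∈ T.faces) (τ : Set T.X) (hτ : τ ∈ T.faces) (hs : τ ⊆ σ) :
    homSupp g h τ hτ = (S.hom T).restrict hs '' homSupp g h σ hσ := by
  classical
  ext p
  constructor
  · rintro ⟨hU, hp⟩
    have hex : ∀ s : S.Ev (homUnion p), ∃ t : T.Ev σ, s ∈ g.supp _ hU →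
        t ∈ h.supp σ hσ ∧ T.restrict hs t = homJoint p s := by
      intro s
      by_cases hg : s ∈ g.supp _ hU
      · have := hp s hg
        rw [h.compat σ hσ τ hτ hs] at this
        obtain ⟨t, ht, hts⟩ := this
        exact ⟨t, fun _ => ⟨ht, hts⟩⟩
      · exact ⟨fun x _ => (T.nonempty_O x).some, fun h => absurd h hg⟩
    choose t ht using hex
    let q : (S.hom T).Ev σ := fun x hx =>
      if hxτ : x ∈ τ then p x hxτ else ⟨homUnion p, fun s => t s x hx⟩
    have hqp : ∀ x (hx : x ∈ τ), q x (hs hx) = p x hx := fun x hx => dif_pos hx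
    have hq : ∀ x (hx : x ∈ σ), (q x hx).1 ⊆ homUnion p := by
      intro x hx
      by_cases hxτ : x ∈ τ
      · intro y hy
        rw [hqp x hxτ] at hy
        exact ⟨x, hxτ, hy⟩
      · intro y hy
        have : q x hx = ⟨homUnion p, fun s => t s x hx⟩ := dif_neg hxτ
        rwa [this] at hy
    have hqU : homUnion q = homUnion p := by
      apply Set.Subset.antisymm
      · rintro y ⟨x, hx, hy⟩; exact hq x hx hy
      · rintro y ⟨x, hx, hy⟩
        refine ⟨x, hs hx, ?_⟩
        rwa [hqp x hx]
    have hval : ∀ x (hx : x ∈ σ) (s : S.Ev (homUnion p)), s ∈ g.supp _ hU →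
        (q x hx).2 (fun y hy => s y (hq x hx hy)) = t s x hx := by
      intro x hx s hsg
      have aux : ∀ (o : (S.hom T).O x) (ho : q x hx = o) (ho' : o.1 ⊆ homUnion p),
          (q x hx).2 (fun y hy => s y (hq x hx hy)) = o.2 (fun y hy => s y (ho' hy)) := by
        rintro o rfl ho'; rfl
      by_cases hxτ : x ∈ τ
      · rw [aux _ (hqp x hxτ) (fun y hy => ⟨x, hxτ, hy⟩)]
        exact (congrFun (congrFun (ht s hsg).2 x) hxτ).symm
      · rw [aux ⟨homUnion p, fun s => t s x hx⟩ (dif_neg hxτ) le_rfl]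
    refine ⟨q, ⟨hqU ▸ hU, ?_⟩, funext fun x => funext fun hx => hqp x hx⟩
    intro s hsg
    rw [g.compat _ hU _ (hqU ▸ hU) hqU.subset] at hsg
    obtain ⟨s, hsg, rfl⟩ := hsg
    have : homJoint q (S.restrict hqU.subset s) = t s :=
      funext fun x => funext fun hx => hval x hx s hsg
    rw [this]
    exact (ht s hsg).1
  · rintro ⟨q, ⟨hU, hq⟩, rfl⟩
    have hsub : homUnion ((S.hom T).restrict hs q) ⊆ homUnion q := by
      rintro y ⟨x, hx, hy⟩; exact ⟨x, hs hx, hy⟩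
    refine ⟨S.down_closed _ hU _ hsub, fun s hsg => ?_⟩
    rw [g.compat _ hU _ _ hsub] at hsg
    obtain ⟨s, hsg, rfl⟩ := hsg
    rw [h.compat σ hσ τ hτ hs]
    exact ⟨_, hq s hsg, rfl⟩

theorem homSupp_nonempty {S T : Scenario.{u}} (g : PossModel S) (h : PossModel T) (σ : Set T.X)
    (hσ : σ ∈ T.faces) : (homSupp g h σ hσ).Nonempty := by
  have hne : (homSupp g h ∅ T.empty_mem).Nonempty := by
    refine ⟨fun x hx => absurd hx (Set.notMem_empty x),
      S.down_closed ∅ S.empty_mem _ (by rintro y ⟨x, hx, -⟩; exact hx), fun s _ => ?_⟩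
    obtain ⟨t, ht⟩ := h.nonempty ∅ T.empty_mem
    have hst : ∀ t' : T.Ev ∅, t' = t := fun t' =>
      funext fun x => funext fun hx => absurd hx (Set.notMem_empty x)
    rw [hst (homJoint _ s)]
    exact ht
  rw [homSupp_compat g h σ hσ ∅ T.empty_mem (Set.empty_subset σ)] at hne
  exact hne.of_image

/-- The model that induces the structure predicate `⋁_σ g_σ` of `[⟨S, g⟩, ⟨T, h⟩]`, where `g_σ` is
the deterministic predicate given by the subset `homSupp g h σ`. -/
def homModel {S T : Scenario.{u}} (g : PossModel S) (h : PossModel T) : PossModel (S.hom T) where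
  supp := homSupp g h
  nonempty := homSupp_nonempty g h
  compat := homSupp_compat g h

/-- The object `[⟨S, g⟩, ⟨T, h⟩]`. -/
abbrev ScengDet.ihom (A B : ScengDet.{u}) : ScengDet.{u} where
  scen := A.scen.hom B.scen
  model := homModel A.model B.model

/-- The empty scenario `0`. -/
abbrev zero : Scenario.{u} where
  X := PEmpty
  O := PEmpty.elim
  faces := Set.univ
  finite_X := inferInstance
  finite_O x := x.elim
  nonempty_O x := x.elim
  empty_mem := trivial
  singleton_mem _ := trivial
  down_closed _ _ _ _ := trivial

/-- The unit object `⟨0, t⟩`, where `t` is induced by the unique model on the empty scenario. -/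
abbrev ScengDet.unit : ScengDet.{u} where
  scen := zero
  model := PossModel.det fun x => x.elim

/-- The procedure underlying `[id, f] : [P, S] → [P, T]` for `f : S → T`: its relation is that of
`f`, and it sends `(⟨U_y, k_y⟩)_{y ∈ π x}` to `⟨⋃ U_y, α_x ∘ (k_y ∘ ρ_y)_y⟩`. -/
def DetProc.postcomp (P : Scenario.{u}) {S T : Scenario.{u}} (f : DetProc S T) :
    DetProc (P.hom S) (P.hom T) where
  π := f.π
  simplicial := f.simplicial
  α x p := ⟨homUnion p, fun s => f.α x (homJoint p s)⟩

/-- The procedure underlying `[f, id] : [T, P] → [S, P]` for `f : S → T`: its relation is the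
identity, and it sends `⟨U, k⟩` to `⟨π U, k ∘ α_U⟩`. -/
def DetProc.precomp {S T : Scenario.{u}} (f : DetProc S T) (P : Scenario.{u}) :
    DetProc (T.hom P) (S.hom P) where
  π x := {x}
  simplicial := (DetProc.id P).simplicial
  α x p := ⟨relImage f.π (p x rfl).1, fun s => (p x rfl).2 (f.act _ s)⟩

/-- The procedure underlying `i : S → [0, S]`: its relation is the identity, and an outcome of `x`
is sent to the function on the one-point set `Ev_0 ∅` with this value. -/
def procI (S : Scenario.{u}) : DetProc S (zero.{u}.hom S) where
  π x := {x}
  simplicial := (DetProc.id S).simplicial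
  α x s := ⟨∅, fun _ => s x rfl⟩

/-- The procedure underlying `j : 0 → [S, S]`: its relation is empty, and at `x` its value is the
identity function `Ev_S {x} → O_{S,x}`. -/
def procJ (S : Scenario.{u}) : DetProc zero.{u} (S.hom S) where
  π _ := ∅
  simplicial _ _ := trivial
  α x _ := ⟨{x}, fun s => s x rfl⟩

/-- The procedure underlying `L : [S, T] → [[P, S], [P, T]]`: its relation is the identity, and
`⟨U, k⟩` is sent to `⟨U, k'⟩` where `k'` is composition with `k`, that is
`(⟨V_y, m_y⟩)_{y ∈ U} ↦ ⟨⋃ V_y, k ∘ (m_y ∘ ρ_y)_y⟩`. -/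
def procL (P S T : Scenario.{u}) : DetProc (S.hom T) ((P.hom S).hom (P.hom T)) where
  π x := {x}
  simplicial := (DetProc.id T).simplicial
  α x p := ⟨(p x rfl).1, fun m => ⟨homUnion m, fun s => (p x rfl).2 (homJoint m s)⟩⟩

end Contextuality

/-! ### Closed categories -/

/-- The structure of a closed category on `𝒱` whose internal hom is `hom` on objects and whose unit
is `one`: the internal hom is made into a functor `𝒱ᵒᵖ × 𝒱 ⥤ 𝒱` (`map`), and there are
a natural isomorphism `i A : A ≅ [1, A]`, a dinatural transformation `j A : 1 ⟶ [A, A]`, and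
a transformation `L A B C : [B, C] ⟶ [[A, B], [A, C]]`, natural in `B` and `C` and dinatural
in `A`, subject to the axioms CC1-CC5. -/
structure ClosedStructure (𝒱 : Type u) [Category.{v} 𝒱] (hom : 𝒱 → 𝒱 → 𝒱) (one : 𝒱) where
  map : ∀ {A A' B B' : 𝒱}, (A' ⟶ A) → (B ⟶ B') → (hom A B ⟶ hom A' B')
  map_id : ∀ A B : 𝒱, map (𝟙 A) (𝟙 B) = 𝟙 (hom A B)
  map_comp : ∀ {A A' A'' B B' B'' : 𝒱} (f' : A'' ⟶ A') (f : A' ⟶ A) (g : B ⟶ B') (g' : B' ⟶ B''),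
    map (f' ≫ f) (g ≫ g') = map f g ≫ map f' g'
  i : ∀ A : 𝒱, A ≅ hom one A
  i_natural : ∀ {A B : 𝒱} (f : A ⟶ B), f ≫ (i B).hom = (i A).hom ≫ map (𝟙 one) f
  j : ∀ A : 𝒱, one ⟶ hom A A
  j_dinatural : ∀ {A B : 𝒱} (f : A ⟶ B), j A ≫ map (𝟙 A) f = j B ≫ map f (𝟙 B)
  L : ∀ A B C : 𝒱, hom B C ⟶ hom (hom A B) (hom A C)
  L_natural_left : ∀ (A C : 𝒱) {B B' : 𝒱} (f : B' ⟶ B),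
    map f (𝟙 C) ≫ L A B' C = L A B C ≫ map (map (𝟙 A) f) (𝟙 (hom A C))
  L_natural_right : ∀ (A B : 𝒱) {C C' : 𝒱} (f : C ⟶ C'),
    map (𝟙 B) f ≫ L A B C' = L A B C ≫ map (𝟙 (hom A B)) (map (𝟙 A) f)
  L_dinatural : ∀ (B C : 𝒱) {A A' : 𝒱} (f : A' ⟶ A),
    L A B C ≫ map (𝟙 (hom A B)) (map f (𝟙 C)) = L A' B C ≫ map (map f (𝟙 B)) (𝟙 (hom A' C))
  CC1 : ∀ A B : 𝒱, j B ≫ L A B B = j (hom A B)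
  CC2 : ∀ A C : 𝒱, L A A C ≫ map (j A) (𝟙 (hom A C)) = (i (hom A C)).hom
  CC3 : ∀ A B C D : 𝒱,
    L A C D ≫ L (hom A B) (hom A C) (hom A D) ≫
        map (L A B C) (𝟙 (hom (hom A B) (hom A D))) =
      L B C D ≫ map (𝟙 (hom B C)) (L A B D)
  CC4 : ∀ B C : 𝒱, L one B C ≫ map (i B).hom (𝟙 (hom one C)) = map (𝟙 B) (i C).hom
  CC5 : ∀ A B : 𝒱, Function.Bijective fun f : A ⟶ B => j A ≫ map (𝟙 A) f

/-- The internal-hom bifunctor of a closed structure. -/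
def ClosedStructure.bifunctor {𝒱 : Type u} [Category.{v} 𝒱] {hom : 𝒱 → 𝒱 → 𝒱} {one : 𝒱}
    (K : ClosedStructure 𝒱 hom one) : 𝒱ᵒᵖ × 𝒱 ⥤ 𝒱 where
  obj A := hom A.1.unop A.2
  map f := K.map f.1.unop f.2
  map_id A := K.map_id A.1.unop A.2
  map_comp f g := K.map_comp g.1.unop f.1.unop f.2 g.2

open Contextuality

namespace Contextuality

/-! ### Extensionality along global assignments

Outcome sets are non-empty, so every local assignment extends to a global one. Functions on
`S.Ev U` can therefore be compared on restrictions of global assignments, even when their domains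
are only propositionally equal. -/

/-! An outcome `⟨U, k⟩` of `[S, T]` is a function together with a record of the measurements it
reads. A family of such outcomes lies in `homSupp` when, jointly, it reads a context and maps the
support there into the support of the target. On outcomes, `i` forms constants, `j` is the identity
function, `L` is composition, and the two functorial actions are post- and precomposition.

Hence every equation of a closed category has two layers. Once evaluated at assignments, the
functions agree by the laws of composition, almost always definitionally. The sets of measurements
agree because unions are associative and relational images commute with unions. `ScengDet.hom_ext`
and `Scenario.hom_outcome_ext` separate the two layers.

That the procedures are morphisms rests on `PossModel.satisfies_predicate_iff`: being a morphism
means mapping supports into supports (`ScengDet.homMk`, `ScengDet.Hom.act_mem`). For CC5, a morphism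
`1 ⟶ [A, B]` chooses one outcome `⟨U_x, k_x⟩` for each `x`, which is the data of a procedure;
membership of this choice in `homSupp` at every context is what makes the procedure a morphism `A ⟶
B`. -/

theorem Scenario.exists_global {S : Scenario.{u}} {U : Set S.X} (s : S.Ev U) :
    ∃ t : ∀ x, S.O x, (fun x _ => t x) = s := by
  classical
  refine ⟨fun x => if hx : x ∈ U then s x hx else (S.nonempty_O x).some, ?_⟩
  funext x hx
  exact dif_pos hx

theorem DetProc.ext_global {S T : Scenario.{u}} {f g : DetProc S T} (hπ : ∀ x, f.π x = g.π x)
    (hα : ∀ x (s : ∀ y, S.O y), f.α x (fun y _ => s y) = g.α x fun y _ => s y) : f = g := by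
  refine ext_of hπ fun x s => ?_
  obtain ⟨t, rfl⟩ := Scenario.exists_global s
  exact hα x t

/-- As `Z` is arbitrary, it may itself be a type of such pairs, so the lemma can be applied once per
level of a nested internal hom. -/
theorem Scenario.hom_outcome_ext {S : Scenario.{u}} {Z : Type u}
    {o o' : Σ U : Set S.X, (S.Ev U → Z)} (hU : o.1 = o'.1)
    (hk : ∀ s : ∀ y, S.O y, o.2 (fun y _ => s y) = o'.2 fun y _ => s y) : o = o' := by
  obtain ⟨U, k⟩ := o
  obtain ⟨U', k'⟩ := o'
  obtain rfl : U = U' := hU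
  obtain rfl : k = k' := by
    funext s
    obtain ⟨t, rfl⟩ := exists_global s
    exact hk t
  rfl

/-! ### Identities for relational images and unions of measurement sets. -/

theorem relImage_singleton {X Y : Type u} (R : X → Set Y) (x : X) : relImage R {x} = R x := by
  ext y; simp [relImage]

theorem relImage_id {X : Type u} (U : Set X) : relImage (fun x => {x}) U = U := by
  ext y; simp [relImage]

theorem relImage_relImage {X Y Z : Type u} (R : X → Set Y) (R' : Y → Set Z) (U : Set X) :
    relImage R' (relImage R U) = relImage (fun x => relImage R' (R x)) U := by
  ext z
  constructor
  · rintro ⟨y, ⟨x, hx, hy⟩, hz⟩; exact ⟨x, hx, y, hy, hz⟩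
  · rintro ⟨x, hx, y, hy, hz⟩; exact ⟨y, ⟨x, hx, hy⟩, hz⟩

theorem zero_set_eq (U V : Set zero.{u}.X) : U = V :=
  Set.ext fun y => PEmpty.elim y

theorem zero_ev_eq {U : Set zero.{u}.X} (s t : zero.Ev U) : s = t :=
  funext fun y => PEmpty.elim y

theorem homUnion_singleton {S T : Scenario.{u}} {x : T.X} (p : (S.hom T).Ev {x}) :
    homUnion p = (p x rfl).1 := by
  ext y
  constructor
  · rintro ⟨_, rfl, hy⟩; exact hy
  · exact fun hy => ⟨x, rfl, hy⟩

/-! ### Morphisms in terms of supports -/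

theorem PossModel.restrict_mem {S : Scenario.{u}} (e : PossModel S) {σ τ : Set S.X}
    {hσ : σ ∈ S.faces} (h : τ ⊆ σ) {s : S.Ev σ} (hs : s ∈ e.supp σ hσ) :
    S.restrict h s ∈ e.supp τ (S.down_closed σ hσ τ h) := by
  rw [e.compat σ hσ τ _ h]
  exact ⟨s, hs, rfl⟩

/-- Used whenever a constructed family reads a set merely known to lie inside a context: possible
assignments on the smaller set extend to possible assignments on the context, where the hypotheses
apply. -/
theorem PossModel.exists_restrict_eq {S : Scenario.{u}} (e : PossModel S) {σ τ : Set S.X}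
    (hσ : σ ∈ S.faces) {hτ : τ ∈ S.faces} (h : τ ⊆ σ) {s : S.Ev τ} (hs : s ∈ e.supp τ hτ) :
    ∃ t ∈ e.supp σ hσ, S.restrict h t = s := by
  rwa [e.compat σ hσ τ hτ h] at hs

/-- A model satisfies the predicate induced by `g` exactly if its supports are contained in
those of `g`. -/
theorem PossModel.satisfies_predicate_iff {S : Scenario.{u}} (e g : PossModel S) :
    e.Satisfies g.predicate ↔ ∀ σ hσ, e.supp σ hσ ⊆ g.supp σ hσ := by
  constructor
  · intro h σ hσ s hs
    have hsub : relImage (fun _ : PUnit.{u + 1} => σ) Set.univ ⊆ σ := fun _ ⟨_, _, hy⟩ => hy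
    have hm : (detPredicate S σ hσ (g.supp σ hσ)).act Set.univ (S.restrict hsub s) ∈
        (g.predicate.push e).supp Set.univ trivial :=
      ⟨_, ⟨σ, hσ, rfl⟩, _, e.restrict_mem hsub hs, rfl⟩
    rw [show g.predicate.push e = _ from h] at hm
    have hv := congrArg ULift.down (congrFun (congrFun hm PUnit.unit) trivial)
    exact @of_decide_eq_true _ (Classical.propDecidable _) hv
  · intro h
    refine PossModel.ext (funext fun τ => funext fun hτ => ?_)
    -- The target support is a singleton and supports are non-empty, so one inclusion suffices.
    refine Set.Nonempty.subset_singleton_iff ((g.predicate.push e).nonempty τ hτ) |>.1 ?_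
    rintro _ ⟨_, ⟨σ, hσ, rfl⟩, s, hs, rfl⟩
    refine Set.mem_singleton_iff.2 (funext fun x => funext fun hx => ?_)
    -- This needs the element `x` of `τ`: over the empty context the image is empty, but there no
    -- outcome has to be compared.
    have hsub : σ ⊆ relImage (fun _ : PUnit.{u + 1} => σ) τ := fun y hy => ⟨x, hx, hy⟩
    exact congrArg ULift.up
      (@decide_eq_true _ (Classical.propDecidable _) (h σ hσ (e.restrict_mem hsub hs)))

/-- A procedure is a morphism as soon as it maps supports into supports. -/
def ScengDet.homMk {A B : ScengDet.{u}} (f : DetProc A.scen B.scen)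
    (hf : ∀ σ hσ, ∀ s ∈ A.model.supp _ (f.simplicial σ hσ), f.act σ s ∈ B.model.supp σ hσ) :
    A ⟶ B where
  proc := f
  preserves e he := by
    have he' := (PossModel.satisfies_predicate_iff _ _).1 he
    refine (PossModel.satisfies_predicate_iff _ _).2 fun σ hσ => ?_
    rintro _ ⟨s, hs, rfl⟩
    exact hf σ hσ s (he' _ _ hs)

/-- Converse to `homMk`: the model of `A` satisfies its own predicate, so `f` can be tested on it.
-/
theorem ScengDet.Hom.act_mem {A B : ScengDet.{u}} (f : A ⟶ B) {σ : Set B.scen.X}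
    (hσ : σ ∈ B.scen.faces) {s : A.scen.Ev (relImage f.proc.π σ)}
    (hs : s ∈ A.model.supp _ (f.proc.simplicial σ hσ)) :
    f.proc.act σ s ∈ B.model.supp σ hσ :=
  (PossModel.satisfies_predicate_iff _ _).1
    (f.preserves A.model ((PossModel.satisfies_predicate_iff _ _).2 fun _ _ => le_rfl)) σ hσ
    ⟨s, hs, rfl⟩

theorem ScengDet.hom_ext {A B : ScengDet.{u}} {f g : A ⟶ B}
    (hπ : ∀ x, f.proc.π x = g.proc.π x)
    (hα : ∀ x (s : ∀ y, A.scen.O y),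
      f.proc.α x (fun y _ => s y) = g.proc.α x fun y _ => s y) : f = g :=
  ScengDet.Hom.ext (DetProc.ext_global hπ hα)

/-! ### The structure morphisms -/

namespace ScengDet

/-- Functoriality of the internal hom in its second argument. -/
def post (P : ScengDet.{u}) {A B : ScengDet.{u}} (f : A ⟶ B) : P.ihom A ⟶ P.ihom B :=
  homMk (f.proc.postcomp P.scen) <| by
    rintro σ hσ p ⟨hU, hp⟩
    have hsub : homUnion ((f.proc.postcomp P.scen).act σ p) ⊆ homUnion p := by
      rintro z ⟨x, hx, y, hy, hz⟩; exact ⟨y, ⟨x, hx, hy⟩, hz⟩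
    refine ⟨P.scen.down_closed _ hU _ hsub, fun s hs => ?_⟩
    obtain ⟨t, ht, rfl⟩ := P.model.exists_restrict_eq hU hsub hs
    -- The joint function of the new family is `f.proc.act σ` after that of `p`, by definition.
    exact Hom.act_mem f hσ (hp t ht)

/-- Functoriality of the internal hom in its first argument. -/
def pre {A B : ScengDet.{u}} (f : A ⟶ B) (P : ScengDet.{u}) : B.ihom P ⟶ A.ihom P :=
  homMk (f.proc.precomp P.scen) <| by
    rintro σ hσ p ⟨hU, hp⟩
    have hsub : homUnion ((f.proc.precomp P.scen).act σ p) ⊆ relImage f.proc.π (homUnion p) := by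
      rintro z ⟨x, hx, y, hy, hz⟩; exact ⟨y, ⟨x, ⟨x, hx, rfl⟩, hy⟩, hz⟩
    refine ⟨A.scen.down_closed _ (f.proc.simplicial _ hU) _ hsub, fun s hs => ?_⟩
    obtain ⟨t, ht, rfl⟩ := A.model.exists_restrict_eq (f.proc.simplicial _ hU) hsub hs
    -- An identity relation sends `σ` to a set only propositionally equal to `σ`; restricting along
    -- this equality avoids a transport.
    exact P.model.restrict_mem (relImage_id _).ge (hp _ (Hom.act_mem f hU ht))

/-- The isomorphism `A ≅ [1, A]`. -/
def unitIso (A : ScengDet.{u}) : A ≅ unit.ihom A where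
  hom := homMk (procI A.scen) fun σ hσ s hs =>
    ⟨trivial, fun _ _ => A.model.restrict_mem (relImage_id _).ge hs⟩
  -- The inverse evaluates each function at the unique assignment on the empty scenario.
  inv := homMk
    { π := fun x => {x}
      simplicial := (DetProc.id A.scen).simplicial
      α := fun x p => (p x rfl).2 fun y _ => y.elim } <| by
    rintro σ hσ p ⟨hU, hp⟩
    have h := hp (fun y _ => y.elim) rfl
    convert A.model.restrict_mem (relImage_id _).ge h using 1
    funext x hx
    exact congrArg (p x _).2 (zero_ev_eq _ _)
  hom_inv_id := hom_ext (fun x => relImage_id _) fun _ _ => rfl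
  inv_hom_id := hom_ext (fun x => relImage_id _) fun x p =>
    Scenario.hom_outcome_ext (zero_set_eq _ _) fun s =>
      congrArg (p x).2 (zero_ev_eq _ _)

/-- The name `1 ⟶ [A, A]` of the identity. -/
def idName (A : ScengDet.{u}) : unit ⟶ A.ihom A :=
  homMk (procJ A.scen) <| by
    intro σ hσ p _
    have hsub : homUnion ((procJ A.scen).act σ p) ⊆ σ := by
      rintro y ⟨x, hx, hy⟩
      obtain rfl : y = x := hy
      exact hx
    refine ⟨A.scen.down_closed _ hσ _ hsub, fun s hs => ?_⟩
    obtain ⟨t, ht, rfl⟩ := A.model.exists_restrict_eq hσ hsub hs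
    exact ht

/-- The morphism `[A, B] ⟶ [[P, A], [P, B]]`. -/
def compHom (P A B : ScengDet.{u}) : A.ihom B ⟶ (P.ihom A).ihom (P.ihom B) :=
  homMk (procL P.scen A.scen B.scen) <| by
    rintro σ hσ p ⟨hU, hp⟩
    have hsub : homUnion ((procL P.scen A.scen B.scen).act σ p) ⊆
        homUnion (S := A.scen) (T := B.scen) p := by
      rintro y ⟨x, hx, hy⟩; exact ⟨x, ⟨x, hx, rfl⟩, hy⟩
    refine ⟨A.scen.down_closed _ hU _ hsub, fun m hm => ?_⟩
    -- Two extensions are needed, one per level: `m` to all measurements read by `p`, then `s` to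
    -- all those read by the extended `m`. After that, `hm'` and `hp` compose.
    obtain ⟨m, ⟨hV, hm'⟩, rfl⟩ := (P.ihom A).model.exists_restrict_eq hU hsub hm
    have hsub' : homUnion (homJoint ((procL P.scen A.scen B.scen).act σ p)
        ((P.scen.hom A.scen).restrict hsub m)) ⊆ homUnion m := by
      rintro z ⟨x, hx, y, hy, hz⟩; exact ⟨y, ⟨x, ⟨x, hx, rfl⟩, hy⟩, hz⟩
    refine ⟨P.scen.down_closed _ hV _ hsub', fun s hs => ?_⟩
    obtain ⟨t, ht, rfl⟩ := P.model.exists_restrict_eq hV hsub' hs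
    exact B.model.restrict_mem (relImage_id _).ge (hp _ (hm' t ht))

/-! ### Functoriality -/

theorem pre_id (A P : ScengDet.{u}) : pre (𝟙 A) P = 𝟙 (A.ihom P) :=
  hom_ext (fun _ => rfl) fun _ _ => Scenario.hom_outcome_ext (relImage_id _) fun _ => rfl

theorem post_id (P A : ScengDet.{u}) : post P (𝟙 A) = 𝟙 (P.ihom A) :=
  hom_ext (fun _ => rfl) fun _ _ => Scenario.hom_outcome_ext (homUnion_singleton _) fun _ => rfl

theorem pre_comp {A B C : ScengDet.{u}} (f : A ⟶ B) (g : B ⟶ C) (P : ScengDet.{u}) :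
    pre (f ≫ g) P = pre g P ≫ pre f P :=
  hom_ext (fun _ => (relImage_id _).symm) fun _ _ =>
    Scenario.hom_outcome_ext (relImage_relImage _ _ _).symm fun _ => rfl

theorem post_comp (P : ScengDet.{u}) {A B C : ScengDet.{u}} (f : A ⟶ B) (g : B ⟶ C) :
    post P (f ≫ g) = post P f ≫ post P g :=
  hom_ext (fun _ => rfl) fun x p => Scenario.hom_outcome_ext (by
    ext z
    constructor
    · rintro ⟨y, ⟨w, hw, hy⟩, hz⟩; exact ⟨w, hw, y, hy, hz⟩
    · rintro ⟨w, hw, y, hy, hz⟩; exact ⟨y, ⟨w, hw, hy⟩, hz⟩) fun _ => rfl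

/-- Pre- and postcomposition commute, since a relational image of a union is the union of the
images. This interchange is what makes the two partial functors a bifunctor. -/
theorem post_comp_pre {A A' B B' : ScengDet.{u}} (f : A' ⟶ A) (g : B ⟶ B') :
    post A g ≫ pre f B' = pre f B ≫ post A' g :=
  hom_ext (fun _ => (relImage_singleton _ _).trans (relImage_id _).symm) fun x p =>
    Scenario.hom_outcome_ext (by
      ext z
      constructor
      · rintro ⟨y, ⟨w, hw, hy⟩, hz⟩; exact ⟨w, hw, y, hy, hz⟩
      · rintro ⟨w, hw, y, hy, hz⟩; exact ⟨y, ⟨w, hw, hy⟩, hz⟩) fun _ => rfl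

/-! ### Naturality -/

theorem unitIso_natural {A B : ScengDet.{u}} (f : A ⟶ B) :
    f ≫ (unitIso B).hom = (unitIso A).hom ≫ post unit f :=
  hom_ext (fun _ => (relImage_singleton _ _).trans (relImage_id _).symm) fun _ _ =>
    Scenario.hom_outcome_ext (zero_set_eq _ _) fun _ => rfl

/-- Both sides are the name of `f`, with value `⟨π x, α x⟩` at `x`. -/
theorem idName_dinatural {A B : ScengDet.{u}} (f : A ⟶ B) :
    idName A ≫ post A f = idName B ≫ pre f B :=
  hom_ext (fun _ => zero_set_eq _ _) fun x _ =>
    Scenario.hom_outcome_ext (by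
      ext z
      constructor
      · rintro ⟨y, hy, hz⟩
        obtain rfl : z = y := hz
        exact ⟨x, rfl, hy⟩
      · rintro ⟨_, rfl, hz⟩; exact ⟨z, hz, rfl⟩) fun _ => rfl

theorem compHom_natural_left (A C : ScengDet.{u}) {B B' : ScengDet.{u}} (f : B' ⟶ B) :
    pre f C ≫ compHom A B' C = compHom A B C ≫ pre (post A f) (A.ihom C) :=
  hom_ext (fun _ => rfl) fun x p => Scenario.hom_outcome_ext rfl fun m =>
    Scenario.hom_outcome_ext (by
      ext z
      constructor
      · rintro ⟨y, ⟨w, hw, hy⟩, hz⟩; exact ⟨w, hw, y, hy, hz⟩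
      · rintro ⟨w, hw, y, hy, hz⟩; exact ⟨y, ⟨w, hw, hy⟩, hz⟩) fun _ => rfl

theorem compHom_natural_right (A B : ScengDet.{u}) {C C' : ScengDet.{u}} (f : C ⟶ C') :
    post B f ≫ compHom A B C' = compHom A B C ≫ post (A.ihom B) (post A f) :=
  hom_ext (fun _ => (relImage_singleton _ _).trans (relImage_id _).symm) fun x p =>
    Scenario.hom_outcome_ext rfl fun m => Scenario.hom_outcome_ext (by
      ext z
      constructor
      · rintro ⟨y, ⟨w, hw, hy⟩, hz⟩; exact ⟨w, hw, y, hy, hz⟩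
      · rintro ⟨w, hw, y, hy, hz⟩; exact ⟨y, ⟨w, hw, hy⟩, hz⟩) fun _ => rfl

theorem compHom_dinatural (B C : ScengDet.{u}) {A A' : ScengDet.{u}} (f : A' ⟶ A) :
    compHom A B C ≫ post (A.ihom B) (pre f C) = compHom A' B C ≫ pre (pre f B) (A'.ihom C) :=
  hom_ext (fun _ => rfl) fun x p => Scenario.hom_outcome_ext
    ((homUnion_singleton _).trans (relImage_id _).symm) fun m => Scenario.hom_outcome_ext (by
      ext z
      constructor
      · rintro ⟨y, ⟨w, hw, hy⟩, hz⟩; exact ⟨w, hw, y, hy, hz⟩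
      · rintro ⟨w, hw, y, hy, hz⟩; exact ⟨y, ⟨w, hw, hy⟩, hz⟩) fun _ => rfl

/-! ### The closed category axioms -/

theorem idName_compHom (A B : ScengDet.{u}) :
    idName B ≫ compHom A B B = idName (A.ihom B) :=
  hom_ext (fun _ => zero_set_eq _ _) fun _ _ =>
    Scenario.hom_outcome_ext rfl fun _ =>
      Scenario.hom_outcome_ext (homUnion_singleton _) fun _ => rfl

theorem compHom_pre_idName (A C : ScengDet.{u}) :
    compHom A A C ≫ pre (idName A) (A.ihom C) = (unitIso (A.ihom C)).hom :=
  hom_ext (fun _ => relImage_id _) fun x p =>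
    Scenario.hom_outcome_ext (zero_set_eq _ _) fun _ =>
      Scenario.hom_outcome_ext (by
        ext z
        constructor
        · rintro ⟨y, hy, hz⟩
          obtain rfl : z = y := hz
          exact hy
        · exact fun hz => ⟨z, hz, rfl⟩) fun _ => rfl

/-- Associativity of composition. The variables `p`, `m`, `n` are assignments of outcomes in `[C,
D]`, `[B, C]`, `[A, B]`; the three set equalities compare the measurements read in `C`, `B` and `A`,
and the last is associativity of unions. -/
theorem compHom_compHom (A B C D : ScengDet.{u}) :
    compHom A C D ≫ compHom (A.ihom B) (A.ihom C) (A.ihom D) ≫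
        pre (compHom A B C) ((A.ihom B).ihom (A.ihom D)) =
      compHom B C D ≫ post (B.ihom C) (compHom A B D) :=
  hom_ext (fun _ => relImage_id _) fun x p => Scenario.hom_outcome_ext
    (by
      ext z
      constructor
      · rintro ⟨_, hz, rfl⟩; exact ⟨x, rfl, hz⟩
      · rintro ⟨_, rfl, hz⟩; exact ⟨z, hz, rfl⟩) fun m => Scenario.hom_outcome_ext (by
      ext z
      constructor
      · rintro ⟨y, hy, hz⟩; exact ⟨y, hy, hz⟩
      · rintro ⟨y, hy, hz⟩; exact ⟨y, hy, hz⟩) fun n => Scenario.hom_outcome_ext (by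
      ext z
      constructor
      · rintro ⟨y, hy, w, hw, hz⟩; exact ⟨w, ⟨y, hy, hw⟩, hz⟩
      · rintro ⟨w, ⟨y, hy, hw⟩, hz⟩; exact ⟨y, hy, w, hw, hz⟩) fun _ => rfl

theorem compHom_unit_pre (B C : ScengDet.{u}) :
    compHom unit B C ≫ pre (unitIso B).hom (unit.ihom C) = post B (unitIso C).hom :=
  hom_ext (fun _ => relImage_id _) fun x p =>
    Scenario.hom_outcome_ext (by
      ext z
      constructor
      · rintro ⟨_, hz, rfl⟩; exact ⟨x, rfl, hz⟩
      · rintro ⟨_, rfl, hz⟩; exact ⟨z, hz, rfl⟩) fun _ =>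
      Scenario.hom_outcome_ext (zero_set_eq _ _) fun _ => rfl

/-- The name `1 ⟶ [A, B]` of a morphism `f : A ⟶ B` takes the value `⟨π x, α x⟩` at `x`. -/
theorem idName_post_α {A B : ScengDet.{u}} (f : A ⟶ B) (x : B.scen.X)
    (s : zero.Ev ((idName A ≫ post A f).proc.π x)) :
    (idName A ≫ post A f).proc.α x s = ⟨f.proc.π x, f.proc.α x⟩ :=
  Scenario.hom_outcome_ext (by
    ext z
    constructor
    · rintro ⟨y, hy, hz⟩
      obtain rfl : z = y := hz
      exact hy
    · exact fun hz => ⟨z, hz, rfl⟩) fun _ => rfl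

/-! ### Morphisms and their names: the bijection of CC5. -/

theorem name_injective (A B : ScengDet.{u}) :
    Function.Injective fun f : A ⟶ B => idName A ≫ post A f := by
  intro f g h
  have hx (x : B.scen.X) : (⟨f.proc.π x, f.proc.α x⟩ : (A.scen.hom B.scen).O x) =
      ⟨g.proc.π x, g.proc.α x⟩ := by
    rw [← idName_post_α f x fun y _ => y.elim, ← idName_post_α g x fun y _ => y.elim]
    have h' : idName A ≫ post A f = idName A ≫ post A g := h
    rw [h']
  -- Evaluating at a global assignment compares second components whose domains differ, without a
  -- cast.
  have aux {x : B.scen.X} {o o' : (A.scen.hom B.scen).O x} (ho : o = o')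
      (s : ∀ y, A.scen.O y) : o.2 (fun y _ => s y) = o'.2 fun y _ => s y := by rw [ho]
  exact hom_ext (fun x => congrArg Sigma.fst (hx x)) fun x s => aux (hx x) s

/-- The first half of membership in `homSupp` makes the relation `x ↦ U_x` simplicial; the second
half makes the resulting procedure preserve supports. -/
theorem name_surjective (A B : ScengDet.{u}) :
    Function.Surjective fun f : A ⟶ B => idName A ≫ post A f := by
  intro n
  let o (x : B.scen.X) : (A.scen.hom B.scen).O x := n.proc.α x fun y _ => y.elim
  have ho (σ : Set B.scen.X) (hσ : σ ∈ B.scen.faces) :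
      (fun x _ => o x : (A.scen.hom B.scen).Ev σ) ∈ homSupp A.model B.model σ hσ :=
    -- The empty assignment is the only point of the unit's support, so `n` must send it to an
    -- admissible family.
    Hom.act_mem n hσ (s := fun y _ => y.elim) rfl
  have hU (σ : Set B.scen.X) : relImage (fun x => (o x).1) σ =
      homUnion (fun x _ => o x : (A.scen.hom B.scen).Ev σ) := by
    ext y
    constructor
    · rintro ⟨x, hx, hy⟩; exact ⟨x, hx, hy⟩
    · rintro ⟨x, hx, hy⟩; exact ⟨x, hx, hy⟩
  let f : A ⟶ B := homMk
    { π := fun x => (o x).1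
      simplicial := fun σ hσ => hU σ ▸ (ho σ hσ).1
      α := fun x => (o x).2 } fun σ hσ s hs => by
    obtain ⟨hV, hk⟩ := ho σ hσ
    exact hk _ (A.model.restrict_mem (hU σ).ge hs)
  refine ⟨f, hom_ext (fun _ => zero_set_eq _ _) fun x s => ?_⟩
  refine (idName_post_α f x _).trans ?_
  exact congrArg (n.proc.α x) (zero_ev_eq _ _)

/-- The closed structure on scenarios with structure predicates. -/
def closedStructure : ClosedStructure ScengDet.{u} ihom unit where
  -- The opposite order gives the same morphism, by `post_comp_pre`.
  map f g := pre f _ ≫ post _ g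
  map_id A B := by rw [pre_id, post_id, Category.comp_id]
  map_comp f' f g g' := by
    rw [pre_comp, post_comp, Category.assoc, Category.assoc, ← Category.assoc (pre f' _),
      ← post_comp_pre, Category.assoc]
  i := unitIso
  i_natural f := by rw [pre_id, Category.id_comp, unitIso_natural]
  j := idName
  j_dinatural f := by
    rw [pre_id, post_id, Category.id_comp, Category.comp_id, idName_dinatural]
  L := compHom
  L_natural_left A C B B' f := by
    simp only [pre_id, post_id, Category.id_comp, Category.comp_id, compHom_natural_left]
  L_natural_right A B C C' f := by
    simp only [pre_id, Category.id_comp, compHom_natural_right]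
  L_dinatural B C A A' f := by
    simp only [pre_id, post_id, Category.id_comp, Category.comp_id, compHom_dinatural]
  CC1 := idName_compHom
  CC2 A C := by rw [post_id, Category.comp_id, compHom_pre_idName]
  CC3 A B C D := by
    rw [pre_id, post_id, Category.id_comp, Category.comp_id, compHom_compHom]
  CC4 B C := by rw [pre_id, post_id, Category.id_comp, Category.comp_id, compHom_unit_pre]
  CC5 A B := by
    simp only [pre_id, Category.id_comp]
    exact ⟨name_injective A B, name_surjective A B⟩

end ScengDet

end Contextuality

/-- The procedures `[id, f]`, `[f, id]`, `i`, `j` and `L` are morphisms of scenarios with structure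
predicates, and they make the internal hom into the structure of a closed category. -/
theorem theorem5 :
    ∃ K : ClosedStructure ScengDet.{u} ScengDet.ihom ScengDet.unit,
      (∀ (P : ScengDet.{u}) {A B : ScengDet.{u}} (f : A ⟶ B),
        (K.map (𝟙 P) f).proc = f.proc.postcomp P.scen) ∧
      (∀ (P : ScengDet.{u}) {A B : ScengDet.{u}} (f : A ⟶ B),
        (K.map f (𝟙 P)).proc = f.proc.precomp P.scen) ∧
      (∀ A : ScengDet.{u}, (K.i A).hom.proc = procI A.scen) ∧
      (∀ A : ScengDet.{u}, (K.j A).proc = procJ A.scen) ∧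
      (∀ P A B : ScengDet.{u}, (K.L P A B).proc = procL P.scen A.scen B.scen) := by
  refine ⟨ScengDet.closedStructure, fun P A B f => ?_, fun P A B f => ?_, fun _ => rfl,
    fun _ => rfl, fun _ _ _ => rfl⟩
  · change (ScengDet.pre (𝟙 P) A ≫ ScengDet.post P f).proc = _
    rw [ScengDet.pre_id, Category.id_comp]
    rfl
  · change (ScengDet.pre f P ≫ ScengDet.post A (𝟙 P)).proc = _
    rw [ScengDet.post_id, Category.comp_id]
    rfl
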